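/- Let $X\in\mathbb{R}^{n\times p}$ with columns $X_1,\dots,X_p$, let $y\in\mathbb{R}^n$ and $\lambda>0$. Assume: (1) The columns of $X$ are in general position: for every $k<\min\{n,p\}$, all distinct indices $i_1,\dots,i_{k+1}$ and all signs $s_1,\dots,s_{k+1}\in\{-1,1\}$, the affine span of $s_1X_{i_1},\dots,s_{k+1}X_{i_{k+1}}$ contains none of the vectors $\pm X_i$ with $i\notin\{i_1,\dots,i_{k+1}\}$. (2) Whenever the columns of $X$ are partitioned (after a permutation) into two nonempty blocks $[X_{(1)}\ X_{(2)}]$ with $X_{(1)}^TX_{(2)}=0$, both $X_{(1)}^Ty$ and $X_{(2)}^Ty$ are nonzero. For a starting point $b^{(0)}\in\mathbb{R}^p$ define the SLOG sequence by $$b^{(k+1)}=(B^{(k)})^{1/2}\left[\lambda I_p+(B^{(k)})^{1/2}X^TX(B^{(k)})^{1/2}\right]^{-1}(B^{(k)})^{1/2}X^Ty,\qquad B^{(k)}=\mathrm{Diag}\left(|b^{(k)}_1|,\dots,|b^{(k)}_p|\right),$$ which is $b^{(k+1)}=\left[X^TX+\lambda (B^{(k)})^{-1}\right]^{-1}X^Ty$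 whenever all components of $b^{(k)}$ are nonzero. Let $b^{(0)}$ be drawn from a probability distribution $P_0$ on $\mathbb{R}^p$ that is absolutely continuous with respect to Lebesgue measure. Then the lasso problem of minimizing $\|y-X\beta\|_2^2+2\lambda\|\beta\|_1$ over $\beta\in\mathbb{R}^p$ has exactly one solution $\hat\beta^{\mathrm{lasso}}$, and $b^{(k)}\to\hat\beta^{\mathrm{lasso}}$ as $k\to\infty$ with $P_0$-probability $1$. -/

import Mathlib

open Matrix MeasureTheory Filter Topology

/-- The lasso objective `‖y - X β‖₂² + 2 lam ‖β‖₁`. -/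
def lassoObjective {n p : ℕ} (X : Matrix (Fin n) (Fin p) ℝ) (y : Fin n → ℝ) (lam : ℝ)
    (β : Fin p → ℝ) : ℝ :=
  ∑ i, (y i - (X *ᵥ β) i) ^ 2 + 2 * lam * ∑ j, |β j|

/-- `β` is a lasso estimator: a global minimizer of the lasso objective. -/
def IsLassoEstimator {n p : ℕ} (X : Matrix (Fin n) (Fin p) ℝ) (y : Fin n → ℝ) (lam : ℝ)
    (β : Fin p → ℝ) : Prop :=
  ∀ β' : Fin p → ℝ, lassoObjective X y lam β ≤ lassoObjective X y lam β'

/-- The columns `X₁, …, X_p` are in general position: for all `k < min n p`, all `k + 1` columns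
(those indexed by `I`) and all signs, the affine span of the signed columns contains none of the
vectors `± X_i` with `i ∉ I`. (The sign of `X_i` is `s i`, which is unconstrained by the signs on
`I`; the empty `I` is harmless because its affine span is empty.) -/
def ColumnsInGeneralPosition {n p : ℕ} (X : Matrix (Fin n) (Fin p) ℝ) : Prop :=
  ∀ I : Finset (Fin p), I.card ≤ min n p →
    ∀ s : Fin p → ℝ, (∀ j, s j = 1 ∨ s j = -1) →
      ∀ i ∉ I, s i • Xᵀ i ∉ affineSpan ℝ ((fun j => s j • Xᵀ j) '' (I : Set (Fin p)))

/-- For every partition of the columns of `X` into two nonempty blocks, indexed by `S` and `Sᶜ`,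
with `X_(1)ᵀ X_(2) = 0`, both `X_(1)ᵀ y` and `X_(2)ᵀ y` are nonzero vectors. -/
def NoTrivialOrthogonalBlock {n p : ℕ} (X : Matrix (Fin n) (Fin p) ℝ) (y : Fin n → ℝ) : Prop :=
  ∀ S : Finset (Fin p), S.Nonempty → Sᶜ.Nonempty →
    (∀ i ∈ S, ∀ j ∈ Sᶜ, (Xᵀ * X) i j = 0) →
      (∃ i ∈ S, (Xᵀ *ᵥ y) i ≠ 0) ∧ (∃ j ∈ Sᶜ, (Xᵀ *ᵥ y) j ≠ 0)

/-- The matrix `B^{1/2}` for `B = Diag(|b₁|, …, |b_p|)`. -/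
noncomputable def sqrtDiag {p : ℕ} (b : Fin p → ℝ) : Matrix (Fin p) (Fin p) ℝ :=
  Matrix.diagonal fun j => Real.sqrt |b j|

/-- One SLOG step, in the form that makes sense for every `b`:
`b ↦ B^{1/2} (lam I + B^{1/2} Xᵀ X B^{1/2})⁻¹ B^{1/2} Xᵀ y`. -/
noncomputable def slogStep {n p : ℕ} (X : Matrix (Fin n) (Fin p) ℝ) (y : Fin n → ℝ) (lam : ℝ)
    (b : Fin p → ℝ) : Fin p → ℝ :=
  (sqrtDiag b * (lam • (1 : Matrix (Fin p) (Fin p) ℝ) + sqrtDiag b * (Xᵀ * X) * sqrtDiag b)⁻¹ *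
    sqrtDiag b) *ᵥ (Xᵀ *ᵥ y)

/-- The SLOG sequence started from `b0`. -/
noncomputable def slogSeq {n p : ℕ} (X : Matrix (Fin n) (Fin p) ℝ) (y : Fin n → ℝ) (lam : ℝ)
    (b0 : Fin p → ℝ) : ℕ → Fin p → ℝ
  | 0 => b0
  | k + 1 => slogStep X y lam (slogSeq X y lam b0 k)

/-- When no component of `b` vanishes, the SLOG step is `(Xᵀ X + lam B⁻¹)⁻¹ Xᵀ y` with
`B = Diag(|b₁|, …, |b_p|)`. -/
theorem slogStep_of_ne_zero {n p : ℕ} (X : Matrix (Fin n) (Fin p) ℝ) (y : Fin n → ℝ) (lam : ℝ)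
    (b : Fin p → ℝ) (hb : ∀ j, b j ≠ 0) :
    slogStep X y lam b =
      (Xᵀ * X + lam • (Matrix.diagonal fun j => |b j|)⁻¹)⁻¹ *ᵥ (Xᵀ *ᵥ y) := by
  have hu : IsUnit (sqrtDiag b).det := by
    rw [sqrtDiag, Matrix.det_diagonal, isUnit_iff_ne_zero]
    exact Finset.prod_ne_zero_iff.2 fun j _ => (Real.sqrt_pos.2 (abs_pos.2 (hb j))).ne'
  have hB : (Matrix.diagonal fun j => |b j|) = sqrtDiag b * sqrtDiag b := by
    rw [sqrtDiag, Matrix.diagonal_mul_diagonal]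
    simp
  have h : Xᵀ * X + lam • (Matrix.diagonal fun j => |b j|)⁻¹ =
      (sqrtDiag b)⁻¹ * (lam • (1 : Matrix (Fin p) (Fin p) ℝ) +
        sqrtDiag b * (Xᵀ * X) * sqrtDiag b) * (sqrtDiag b)⁻¹ := by
    rw [hB, Matrix.mul_inv_rev, Matrix.mul_add, Matrix.add_mul, add_comm]
    congr 1
    · simp
    · rw [Matrix.mul_assoc (sqrtDiag b), Matrix.nonsing_inv_mul_cancel_left _ _ hu,
        Matrix.mul_nonsing_inv_cancel_right _ _ hu]
  rw [h, Matrix.mul_inv_rev, Matrix.mul_inv_rev, Matrix.nonsing_inv_nonsing_inv _ hu,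
    ← Matrix.mul_assoc]
  rfl

/-!
A SLOG step minimizes the quadratic majorant of the lasso objective obtained from
`2 |β j| ≤ β j ^ 2 / |b j| + |b j|`. Everything needed about the step `b'` of `b` is contained in the
equation `lam b' j = |b j| q j`, where `q = Xᵀ (y - X b')` (`lam_mul_slogStep`).

*Convergence.* The objective decreases along the sequence by an amount that controls the increments
(`sq_sub_slogStep_le`), so the sequence is bounded and its increments tend to zero; its cluster
points are fixed points, that is, satisfy `lam β j = |β j| q j`. General position makes columns with
`|q j| = lam` linearly independent (`linearIndepOn_of_abs_corr_eq`), so a fixed point is determined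
by its signs. There are then finitely many fixed points, and the sequence converges to one of them
(`exists_tendsto_slogSeq`).

*Optimality of the limit.* A fixed point violates the KKT conditions of the lasso only if
`|q j| > lam` for some `j` with `β j = 0`. Near such a point each step increases `|b j|`, so a
sequence whose coordinates never vanish cannot converge to it (`exists_lassoKKT_tendsto_slogSeq`). By the same
independence of columns, a KKT point is the unique lasso solution
(`LassoKKT.isLassoEstimator_iff`).

*Almost sure nonvanishing.* If all coordinates of `b'` are nonzero, the equation of the step can be
solved for `|b|` as a differentiable function of `b'`, so null sets pull back to null sets. A
coordinate of `b'` vanishes only where a coordinate of `b` does or where a certain polynomial in `|b|`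
does, and the hypothesis on orthogonal blocks makes that polynomial nonzero as soon as `Xᵀ y ≠ 0`
(`scaledNumerator_ne_zero`). Hence almost no sequence ever has a zero coordinate
(`ae_slogSeq_ne_zero`). If `Xᵀ y = 0`, the sequence is `0` from the first step on, and `0` is the lasso
solution.
-/

/-! ### The lasso: optimality conditions and uniqueness -/

/-- The vector `Xᵀ (y - X β)` of inner products of the columns of `X` with the residual at `β`. -/
def residualCorr {n p : ℕ} (X : Matrix (Fin n) (Fin p) ℝ) (y : Fin n → ℝ) (β : Fin p → ℝ) :
    Fin p → ℝ :=
  Xᵀ *ᵥ (y - X *ᵥ β)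

/-- The Karush–Kuhn–Tucker conditions of the lasso: `Xᵀ (y - X β)` lies in `lam` times the
subdifferential of the `ℓ¹` norm at `β`. The subgradient condition at nonzero coordinates is
written as `q j * β j = lam * |β j|`. -/
def LassoKKT {n p : ℕ} (X : Matrix (Fin n) (Fin p) ℝ) (y : Fin n → ℝ) (lam : ℝ)
    (β : Fin p → ℝ) : Prop :=
  ∀ j, |residualCorr X y β j| ≤ lam ∧ residualCorr X y β j * β j = lam * |β j|

section Lasso

variable {n p : ℕ} {X : Matrix (Fin n) (Fin p) ℝ} {y : Fin n → ℝ} {lam : ℝ}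

/-- General position makes every set of columns that are equicorrelated in absolute value with some
vector `r` linearly independent: a column in the span of independent equicorrelated ones would,
after the sign changes that make all correlations equal to `lam`, be a combination of them whose
coefficients sum to `1`, as pairing with `r` shows. -/
theorem linearIndepOn_of_abs_corr_eq (hX : ColumnsInGeneralPosition X) (hlam : 0 < lam)
    (r : Fin n → ℝ) : LinearIndepOn ℝ (fun j => Xᵀ j) {j | |(Xᵀ *ᵥ r) j| = lam} := by
  classical
  set E : Set (Fin p) := {j | |(Xᵀ *ᵥ r) j| = lam} with hE
  obtain ⟨b, hbE, -, hspan, hb⟩ := exists_linearIndepOn_extension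
    (linearIndepOn_empty ℝ (fun j => Xᵀ j)) (Set.empty_subset E)
  by_cases hEb : E ⊆ b
  · exact hb.mono hEb
  exfalso
  obtain ⟨i, hiE, hib⟩ := Set.not_subset.1 hEb
  obtain ⟨I, rfl⟩ : ∃ I : Finset (Fin p), (I : Set (Fin p)) = b :=
    ⟨b.toFinite.toFinset, by simp⟩
  have hcard : I.card ≤ min n p := by
    refine le_min ?_ (by simpa using I.card_le_univ)
    have := LinearIndependent.fintype_card_le_finrank hb
    simpa using this
  have hi : Xᵀ i ∈ Submodule.span ℝ ((fun j => Xᵀ j) '' (I : Set (Fin p))) :=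
    hspan ⟨i, hiE, rfl⟩
  obtain ⟨c', hc'⟩ := (Submodule.mem_span_image_finset_iff_exists_fun ℝ).1 hi
  obtain ⟨c, hc⟩ : ∃ c : Fin p → ℝ, ∑ j ∈ I, c j • Xᵀ j = Xᵀ i := by
    refine ⟨Function.extend Subtype.val c' 0, ?_⟩
    rw [← hc', ← Finset.sum_coe_sort I]
    exact Finset.sum_congr rfl fun j _ => by rw [Subtype.val_injective.extend_apply]
  set s : Fin p → ℝ := fun j => if 0 ≤ (Xᵀ *ᵥ r) j then 1 else -1 with hs
  have hss : ∀ j, s j = 1 ∨ s j = -1 := fun j => by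
    simp only [hs]; split_ifs <;> simp
  have hs2 : ∀ j, s j * s j = 1 := fun j => by rcases hss j with h | h <;> simp [h]
  have hsE : ∀ j ∈ E, s j * (Xᵀ *ᵥ r) j = lam := by
    intro j hj
    rw [← show |(Xᵀ *ᵥ r) j| = lam from hj]
    simp only [hs]
    split_ifs with h
    · rw [abs_of_nonneg h, one_mul]
    · rw [abs_of_neg (not_le.1 h)]; ring
  have hcorr : ∑ j ∈ I, c j * (Xᵀ *ᵥ r) j = (Xᵀ *ᵥ r) i := by
    have h := congrArg (fun v => v ⬝ᵥ r) hc
    rw [sum_dotProduct] at h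
    simp only [smul_dotProduct] at h
    exact h
  have hw : ∑ j ∈ I, s i * c j * s j = 1 := by
    have h : lam * ∑ j ∈ I, s i * c j * s j = lam := by
      calc lam * ∑ j ∈ I, s i * c j * s j = ∑ j ∈ I, s i * (c j * (Xᵀ *ᵥ r) j) := by
            rw [Finset.mul_sum]
            refine Finset.sum_congr rfl fun j hj => ?_
            rw [← hsE j (hbE hj)]
            linear_combination s i * c j * (Xᵀ *ᵥ r) j * hs2 j
        _ = lam := by rw [← Finset.mul_sum, hcorr, hsE i hiE]
    exact mul_left_cancel₀ hlam.ne' (h.trans (mul_one _).symm)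
  refine hX I hcard s hss i (by simpa using hib) ?_
  have hmem := affineCombination_mem_affineSpan_image (k := ℝ) hw
    (s' := (I : Set (Fin p))) (fun j hj hj' => (hj' hj).elim) (fun j => s j • Xᵀ j)
  rw [Finset.affineCombination_eq_linear_combination _ _ _ hw] at hmem
  convert hmem using 1
  rw [← hc, Finset.smul_sum]
  refine Finset.sum_congr rfl fun j _ => ?_
  rw [smul_smul, smul_smul, mul_assoc, hs2, mul_one]

/-- A vector supported on the equicorrelation set of `r` and killed by `X` vanishes. -/
theorem eq_zero_of_mulVec_eq_zero (hX : ColumnsInGeneralPosition X) (hlam : 0 < lam)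
    (r : Fin n → ℝ) {d : Fin p → ℝ} (hd : ∀ j, d j ≠ 0 → |(Xᵀ *ᵥ r) j| = lam)
    (hXd : X *ᵥ d = 0) : d = 0 := by
  classical
  have h := linearIndepOn_of_abs_corr_eq hX hlam r
  rw [linearIndepOn_iff''] at h
  have hsum : ∑ j ∈ Finset.univ.filter (fun j => d j ≠ 0), d j • Xᵀ j = 0 := by
    rw [Finset.sum_filter_of_ne (p := fun j => d j ≠ 0)
      (fun j _ hj h0 => hj (by rw [h0]; exact zero_smul ℝ _)), ← hXd, mulVec_eq_sum]
    simp
  funext j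
  by_contra hj
  exact hj (h _ d (fun j hj => hd j (by simpa using hj)) (fun j hj => by simpa using hj) hsum j
    (by simpa using hj))

theorem residualCorr_sub (β β' : Fin p → ℝ) :
    residualCorr X y β - residualCorr X y β' = (Xᵀ * X) *ᵥ (β' - β) := by
  simp only [residualCorr, ← mulVec_mulVec, ← mulVec_sub]
  congr 1
  rw [mulVec_sub]
  abel

theorem residualCorr_eq (β : Fin p → ℝ) :
    residualCorr X y β = Xᵀ *ᵥ y - (Xᵀ * X) *ᵥ β := by
  rw [residualCorr, mulVec_sub, mulVec_mulVec]

/-- Second-order expansion of the lasso objective around `β`; it is exact, the smooth part being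
quadratic. -/
theorem lassoObjective_sub (β β' : Fin p → ℝ) :
    lassoObjective X y lam β' - lassoObjective X y lam β =
      (X *ᵥ (β' - β)) ⬝ᵥ (X *ᵥ (β' - β)) +
      2 * ∑ j, ((lam * |β' j| - residualCorr X y β j * β' j) -
        (lam * |β j| - residualCorr X y β j * β j)) := by
  have h1 : ∑ i, (y i - (X *ᵥ β') i) ^ 2 = ∑ i, (y i - (X *ᵥ β) i) ^ 2 +
      (X *ᵥ (β' - β)) ⬝ᵥ (X *ᵥ (β' - β)) - 2 * ((y - X *ᵥ β) ⬝ᵥ (X *ᵥ (β' - β))) := by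
    simp only [dotProduct, Finset.mul_sum, ← Finset.sum_add_distrib, ← Finset.sum_sub_distrib]
    refine Finset.sum_congr rfl fun i _ => ?_
    rw [mulVec_sub]
    simp only [Pi.sub_apply]
    ring
  have h2 : (y - X *ᵥ β) ⬝ᵥ (X *ᵥ (β' - β)) = ∑ j, residualCorr X y β j * (β' j - β j) := by
    rw [dotProduct_mulVec, ← mulVec_transpose]
    rfl
  have h3 : ∑ j, ((lam * |β' j| - residualCorr X y β j * β' j) -
        (lam * |β j| - residualCorr X y β j * β j)) =
      lam * ∑ j, |β' j| - lam * ∑ j, |β j| - ∑ j, residualCorr X y β j * (β' j - β j) := by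
    simp only [Finset.mul_sum, ← Finset.sum_sub_distrib]
    refine Finset.sum_congr rfl fun i _ => ?_
    ring
  rw [h3, lassoObjective, lassoObjective, h1, h2]
  ring

/-- Under general position a KKT point is the only minimizer of the lasso objective. -/
theorem LassoKKT.isLassoEstimator_iff (hX : ColumnsInGeneralPosition X) (hlam : 0 < lam)
    {β : Fin p → ℝ} (h : LassoKKT X y lam β) (β' : Fin p → ℝ) :
    IsLassoEstimator X y lam β' ↔ β' = β := by
  have hterm : ∀ (γ : Fin p → ℝ) (j : Fin p), 0 ≤ (lam * |γ j| - residualCorr X y β j * γ j) -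
      (lam * |β j| - residualCorr X y β j * β j) := by
    intro γ j
    rw [(h j).2, sub_self, sub_zero, sub_nonneg]
    calc residualCorr X y β j * γ j ≤ |residualCorr X y β j| * |γ j| := by
          rw [← abs_mul]; exact le_abs_self _
      _ ≤ lam * |γ j| := mul_le_mul_of_nonneg_right (h j).1 (abs_nonneg _)
  have hsq : ∀ v : Fin n → ℝ, 0 ≤ v ⬝ᵥ v := fun v =>
    Finset.sum_nonneg fun i _ => mul_self_nonneg (v i)
  constructor
  · intro hmin
    have hexp := lassoObjective_sub (X := X) (y := y) (lam := lam) β β'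
    have hle := hmin β
    have hs := Finset.sum_nonneg fun j (_ : j ∈ Finset.univ) => hterm β' j
    have hq := hsq (X *ᵥ (β' - β))
    have hs0 := (Finset.sum_eq_zero_iff_of_nonneg fun j _ => hterm β' j).1
      (le_antisymm (by linarith) hs)
    have hX0 : X *ᵥ (β' - β) = 0 := dotProduct_self_eq_zero.1 (by linarith)
    refine sub_eq_zero.1 (eq_zero_of_mulVec_eq_zero hX hlam (y - X *ᵥ β) (fun j hj => ?_) hX0)
    change |residualCorr X y β j| = lam
    have hval : ∀ a : ℝ, a ≠ 0 → residualCorr X y β j * a = lam * |a| →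
        |residualCorr X y β j| = lam := by
      intro a ha he
      have he' := congrArg abs he
      rw [abs_mul, abs_mul, abs_abs, abs_of_pos hlam] at he'
      exact mul_right_cancel₀ (abs_ne_zero.2 ha) he'
    by_cases hβ : β j = 0
    · refine hval (β' j) (by simpa [hβ] using hj) ?_
      have h0 := hs0 j (Finset.mem_univ j)
      rw [hβ] at h0
      simp only [abs_zero, mul_zero, sub_zero] at h0
      linarith
    · exact hval (β j) hβ (h j).2
  · rintro rfl γ
    have hexp := lassoObjective_sub (X := X) (y := y) (lam := lam) β' γ
    have hs := Finset.sum_nonneg fun j (_ : j ∈ Finset.univ) => hterm γ j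
    have hq := hsq (X *ᵥ (γ - β'))
    linarith

end Lasso

/-! ### One SLOG step: implicit equation and descent -/

section Step

variable {n p : ℕ} (X : Matrix (Fin n) (Fin p) ℝ) (y : Fin n → ℝ) {lam : ℝ}

/-- The SLOG step `b'` of `b` is characterized by `lam b' = B (Xᵀ (y - X b'))`, with no inverse
and no square root. -/
theorem lam_mul_slogStep (hlam : 0 < lam) (b : Fin p → ℝ) (j : Fin p) :
    lam * slogStep X y lam b j = |b j| * residualCorr X y (slogStep X y lam b) j := by
  set D := sqrtDiag b with hD
  set A := lam • (1 : Matrix (Fin p) (Fin p) ℝ) + D * (Xᵀ * X) * D with hA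
  have hDt : Dᵀ = D := by rw [hD, sqrtDiag, diagonal_transpose]
  have hpos : A.PosDef := by
    refine (PosDef.one.smul hlam).add_posSemidef ?_
    have h := posSemidef_conjTranspose_mul_self (X * D)
    rwa [conjTranspose_eq_transpose_of_trivial, transpose_mul, hDt, Matrix.mul_assoc,
      ← Matrix.mul_assoc Xᵀ, ← Matrix.mul_assoc] at h
  have hdet : IsUnit A.det := hpos.det_pos.ne'.isUnit
  set c := Xᵀ *ᵥ y with hc
  set z := A⁻¹ *ᵥ (D *ᵥ c) with hz
  have hb : slogStep X y lam b = D *ᵥ z := by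
    rw [slogStep, ← hD, ← hA, ← hc, hz, ← mulVec_mulVec, ← mulVec_mulVec]
  have hAz : A *ᵥ z = D *ᵥ c := by
    rw [hz, mulVec_mulVec, Matrix.mul_nonsing_inv _ hdet, one_mulVec]
  have hlz : lam • z = D *ᵥ residualCorr X y (D *ᵥ z) := by
    rw [residualCorr_eq, mulVec_sub, ← hc, ← hAz, hA, add_mulVec, smul_mulVec, one_mulVec]
    simp only [mulVec_mulVec, Matrix.mul_assoc]
    abel
  have hDD : D * D = diagonal fun j => |b j| := by
    rw [hD, sqrtDiag, diagonal_mul_diagonal]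
    simp
  have hfin : lam • (D *ᵥ z) = (diagonal fun j => |b j|) *ᵥ residualCorr X y (D *ᵥ z) := by
    rw [← hDD, ← mulVec_mulVec, ← hlz, mulVec_smul]
  rw [hb]
  simpa [mulVec_diagonal] using congrFun hfin j

/-- Sufficient decrease of the lasso objective along a SLOG step, coordinate by coordinate. The
factor `|b j|` stands on the right so that vanishing coordinates need no separate treatment. -/
theorem sq_sub_slogStep_le (hlam : 0 < lam) (b : Fin p → ℝ) :
    ∀ j, lam * (b j - slogStep X y lam b j) ^ 2 ≤
      |b j| * (lassoObjective X y lam b - lassoObjective X y lam (slogStep X y lam b)) := by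
  set b' := slogStep X y lam b with hb'
  set q := residualCorr X y b' with hq
  have hrel : ∀ j, lam * b' j = |b j| * q j := lam_mul_slogStep X y hlam b
  set t : Fin p → ℝ := fun j => (lam * |b j| - q j * b j) - (lam * |b' j| - q j * b' j) with ht
  -- Multiplying the `j`-th summand of the expansion around `b'` by `|b j|` eliminates `q j`.
  have hmul : ∀ j, lam * (b j - b' j) ^ 2 ≤ |b j| * (2 * t j) := by
    intro j
    have h1 : |b j| * (2 * t j) =
        2 * lam * (|b j| ^ 2 - b' j * b j - |b j| * |b' j| + b' j ^ 2) := by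
      simp only [ht]
      linear_combination (2 * b j - 2 * b' j) * hrel j
    rw [h1]
    nlinarith [sq_nonneg (|b j| - |b' j|), sq_abs (b j), sq_abs (b' j),
      mul_nonneg hlam.le (sq_nonneg (|b j| - |b' j|))]
  have hnn : ∀ j, 0 ≤ t j := by
    intro j
    by_cases h0 : b j = 0
    · have h1 : b' j = 0 := by
        have := hrel j
        rw [h0, abs_zero, zero_mul] at this
        exact (mul_eq_zero.1 this).resolve_left hlam.ne'
      simp [ht, h0, h1]
    · have h1 := (mul_nonneg hlam.le (sq_nonneg (b j - b' j))).trans (hmul j)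
      have := nonneg_of_mul_nonneg_right h1 (abs_pos.2 h0)
      linarith
  intro j
  refine (hmul j).trans (mul_le_mul_of_nonneg_left ?_ (abs_nonneg _))
  have hexp := lassoObjective_sub (X := X) (y := y) (lam := lam) b' b
  have hsq : 0 ≤ (X *ᵥ (b - b')) ⬝ᵥ (X *ᵥ (b - b')) :=
    Finset.sum_nonneg fun i _ => mul_self_nonneg _
  have hs : t j ≤ ∑ j, t j := Finset.single_le_sum (fun j _ => hnn j) (Finset.mem_univ j)
  rw [hexp]
  change 2 * t j ≤ _ + 2 * ∑ j, t j
  linarith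

theorem lassoObjective_slogStep_le (hlam : 0 < lam) (b : Fin p → ℝ) :
    lassoObjective X y lam (slogStep X y lam b) ≤ lassoObjective X y lam b := by
  by_cases h : ∃ j, b j ≠ 0
  · obtain ⟨j, hj⟩ := h
    have h1 := (mul_nonneg hlam.le (sq_nonneg _)).trans (sq_sub_slogStep_le X y hlam b j)
    exact sub_nonneg.1 (nonneg_of_mul_nonneg_right h1 (abs_pos.2 hj))
  · push Not at h
    refine le_of_eq (congrArg _ (funext fun j => ?_))
    have := lam_mul_slogStep X y hlam b j
    rw [h j, abs_zero, zero_mul] at this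
    rw [h j, (mul_eq_zero.1 this).resolve_left hlam.ne']

theorem mul_abs_le_lassoObjective (hlam : 0 < lam) (b : Fin p → ℝ) (j : Fin p) :
    2 * lam * |b j| ≤ lassoObjective X y lam b := by
  have h1 : |b j| ≤ ∑ j, |b j| :=
    Finset.single_le_sum (f := fun j => |b j|) (fun j _ => abs_nonneg _) (Finset.mem_univ j)
  have h2 : 0 ≤ ∑ i, (y i - (X *ᵥ b) i) ^ 2 := Finset.sum_nonneg fun i _ => sq_nonneg _
  have h3 := mul_le_mul_of_nonneg_left h1 (by positivity : (0 : ℝ) ≤ 2 * lam)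
  rw [lassoObjective]
  linarith

theorem lassoObjective_nonneg (hlam : 0 < lam) (b : Fin p → ℝ) :
    0 ≤ lassoObjective X y lam b := by
  rw [lassoObjective]
  positivity

end Step

/-! ### Convergence of SLOG iterates without vanishing coordinates -/

/-- A sequence in a compact set whose increments tend to zero and whose cluster points lie in a
finite set converges: eventually its steps are too short to pass from the neighbourhood of one
cluster point to that of another. -/
theorem exists_tendsto_of_finite_mapClusterPt {E : Type*} [MetricSpace E] {K : Set E}
    (hK : IsCompact K) {x : ℕ → E} (hxK : ∀ k, x k ∈ K)
    (hd : Tendsto (fun k => dist (x (k + 1)) (x k)) atTop (𝓝 0)) {F : Set E} (hF : F.Finite)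
    (hcl : ∀ a, MapClusterPt a atTop x → a ∈ F) : ∃ a ∈ F, Tendsto x atTop (𝓝 a) := by
  obtain ⟨a, -, ha⟩ := hK.exists_mapClusterPt_of_frequently
    (Frequently.of_forall (f := atTop) hxK)
  refine ⟨a, hcl a ha, Metric.tendsto_atTop.2 fun ε hε => ?_⟩
  obtain ⟨δ, hδ, hsep⟩ : ∃ δ > 0, ∀ f ∈ F, f ≠ a → 3 * δ ≤ dist f a := by
    have hfin : (F \ {a}).Finite := hF.subset Set.sdiff_subset
    have hopen : ∀ᶠ z in 𝓝 a, z ∉ F \ {a} :=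
      hfin.isClosed.isOpen_compl.mem_nhds (by simp)
    obtain ⟨η, hη, hball⟩ := Metric.eventually_nhds_iff.1 hopen
    refine ⟨η / 3, by positivity, fun f hf hfa => ?_⟩
    by_contra! h
    exact hball (by linarith : dist f a < η) ⟨hf, hfa⟩
  set ρ := min ε δ with hρ
  have hρ0 : 0 < ρ := lt_min hε hδ
  have hnear : ∀ᶠ k in atTop, ∃ f ∈ F, dist (x k) f < ρ := by
    by_contra hcon
    have hfreq : ∃ᶠ k in atTop, x k ∈ K \ ⋃ f ∈ F, Metric.ball f ρ := by
      refine (not_eventually.1 hcon).mono fun k hk => ⟨hxK k, ?_⟩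
      simpa using hk
    obtain ⟨f, hf, hfc⟩ := (hK.diff
      (isOpen_biUnion fun f _ => Metric.isOpen_ball)).exists_mapClusterPt_of_frequently hfreq
    exact hf.2 (Set.mem_biUnion (hcl f hfc) (Metric.mem_ball_self hρ0))
  obtain ⟨N, hN⟩ := eventually_atTop.1 (hnear.and (hd.eventually (gt_mem_nhds hδ)))
  obtain ⟨k₀, hk₀, hk₀a⟩ := frequently_atTop.1
    (mapClusterPt_iff_frequently.1 ha _ (Metric.ball_mem_nhds a hρ0)) N
  refine ⟨k₀, fun k hk => lt_of_lt_of_le ?_ (min_le_left ε δ)⟩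
  induction k, hk using Nat.le_induction with
  | base => exact hk₀a
  | succ k hk ih =>
    obtain ⟨f, hf, hfx⟩ := (hN (k + 1) (by omega)).1
    by_cases hfa : f = a
    · rwa [hfa] at hfx
    exfalso
    have h1 := hsep f hf hfa
    have h2 := (hN k (by omega)).2
    have h3 := dist_triangle4 f (x (k + 1)) (x k) a
    rw [dist_comm f (x (k + 1))] at h3
    have h4 := min_le_right ε δ
    linarith

section Convergence

variable {n p : ℕ} {X : Matrix (Fin n) (Fin p) ℝ} (y : Fin n → ℝ) {lam : ℝ}

/-- The fixed points of the SLOG step are finite in number: two of them with the same signs have the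
same correlations on their common support, on which the columns of `X` are independent. -/
theorem finite_setOf_slog_fixed (hX : ColumnsInGeneralPosition X) (hlam : 0 < lam) :
    {β : Fin p → ℝ | ∀ j, lam * β j = |β j| * residualCorr X y β j}.Finite := by
  refine Set.Finite.of_injOn (f := fun β j => SignType.sign (β j)) (t := Set.univ)
    (fun _ _ => Set.mem_univ _) ?_ Set.finite_univ
  intro β hβ β' hβ' hsign
  have hsg : ∀ j, SignType.sign (β j) = SignType.sign (β' j) := fun j => congrFun hsign j
  have hq : ∀ γ : Fin p → ℝ, (∀ j, lam * γ j = |γ j| * residualCorr X y γ j) → ∀ j, γ j ≠ 0 →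
      residualCorr X y γ j = lam * (SignType.sign (γ j) : ℝ) := by
    intro γ hγ j hj
    refine mul_left_cancel₀ (abs_ne_zero.2 hj) ?_
    rw [← hγ j]
    nth_rewrite 1 [← abs_mul_sign (γ j)]
    ring
  have hzero : ∀ j, β j = 0 ↔ β' j = 0 := fun j => by
    rw [← sign_eq_zero_iff, hsg j, sign_eq_zero_iff]
  have hsupp : ∀ j, (β' - β) j ≠ 0 → β j ≠ 0 := by
    intro j hj h0
    exact hj (by simp [h0, (hzero j).1 h0])
  have hXd : X *ᵥ (β' - β) = 0 := by
    refine dotProduct_self_eq_zero.1 ?_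
    rw [dotProduct_mulVec, ← mulVec_transpose, mulVec_mulVec, ← residualCorr_sub (y := y)]
    refine Finset.sum_eq_zero fun j _ => ?_
    by_cases hj : (β' - β) j = 0
    · rw [hj, mul_zero]
    · have h1 := hsupp j hj
      rw [Pi.sub_apply, hq β hβ j h1, hq β' hβ' j (fun h => h1 ((hzero j).2 h)), hsg j, sub_self,
        zero_mul]
  refine (sub_eq_zero.1 (eq_zero_of_mulVec_eq_zero hX hlam (y - X *ᵥ β) (fun j hj => ?_) hXd)).symm
  change |residualCorr X y β j| = lam
  have h1 := hsupp j hj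
  rw [hq β hβ j h1, abs_mul, abs_of_pos hlam]
  rcases lt_or_gt_of_ne h1 with h | h
  · simp [sign_neg h]
  · simp [sign_pos h]

theorem continuous_residualCorr (X : Matrix (Fin n) (Fin p) ℝ) :
    Continuous (residualCorr X y) := by
  unfold residualCorr
  fun_prop

/-- Every SLOG sequence converges to a fixed point of the step. -/
theorem exists_tendsto_slogSeq (hX : ColumnsInGeneralPosition X) (hlam : 0 < lam)
    (b0 : Fin p → ℝ) :
    ∃ β : Fin p → ℝ, (∀ j, lam * β j = |β j| * residualCorr X y β j) ∧
      Tendsto (fun k => slogSeq X y lam b0 k) atTop (𝓝 β) := by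
  set x : ℕ → Fin p → ℝ := fun k => slogSeq X y lam b0 k with hx
  have hstep : ∀ k, x (k + 1) = slogStep X y lam (x k) := fun k => rfl
  set L : ℕ → ℝ := fun k => lassoObjective X y lam (x k) with hL
  have hanti : Antitone L := antitone_nat_of_succ_le fun k =>
    lassoObjective_slogStep_le X y hlam (x k)
  have hLlim : Tendsto (fun k => L k - L (k + 1)) atTop (𝓝 0) := by
    have h := tendsto_atTop_ciInf hanti ⟨0, by
      rintro _ ⟨k, rfl⟩
      exact lassoObjective_nonneg X y hlam _⟩
    simpa using h.sub (h.comp (tendsto_add_atTop_nat 1))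
  set R := L 0 / (2 * lam) with hR
  have hbd : ∀ k j, |x k j| ≤ R := by
    intro k j
    rw [hR, le_div_iff₀ (by positivity), mul_comm]
    exact (mul_abs_le_lassoObjective X y hlam (x k) j).trans (hanti (Nat.zero_le k))
  have hR0 : 0 ≤ R := div_nonneg (lassoObjective_nonneg X y hlam _) (by positivity)
  have hcoord : ∀ j, Tendsto (fun k => x (k + 1) j - x k j) atTop (𝓝 0) := by
    intro j
    have hsq : Tendsto (fun k => (x (k + 1) j - x k j) ^ 2) atTop (𝓝 0) := by
      refine squeeze_zero (g := fun k => R / lam * (L k - L (k + 1))) (fun k => sq_nonneg _)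
        (fun k => ?_) (by simpa using hLlim.const_mul (R / lam))
      have h1 := sq_sub_slogStep_le X y hlam (x k) j
      have h2 : |x k j| * (L k - L (k + 1)) ≤ R * (L k - L (k + 1)) :=
        mul_le_mul_of_nonneg_right (hbd k j) (sub_nonneg.2 (hanti (Nat.le_succ k)))
      rw [div_mul_eq_mul_div, le_div_iff₀ hlam]
      calc (x (k + 1) j - x k j) ^ 2 * lam = lam * (x k j - slogStep X y lam (x k) j) ^ 2 := by
            rw [hstep]; ring
        _ ≤ R * (L k - L (k + 1)) := h1.trans h2
    have h := hsq.sqrt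
    simp only [Real.sqrt_sq_eq_abs, Real.sqrt_zero] at h
    exact (tendsto_zero_iff_abs_tendsto_zero _).2 h
  have hinc : Tendsto (fun k => x (k + 1) - x k) atTop (𝓝 0) :=
    tendsto_pi_nhds.2 fun j => hcoord j
  have hdist : Tendsto (fun k => dist (x (k + 1)) (x k)) atTop (𝓝 0) := by
    simpa [dist_eq_norm] using hinc.norm
  have hball : ∀ k, x k ∈ Metric.closedBall (0 : Fin p → ℝ) R := fun k => by
    rw [mem_closedBall_zero_iff, pi_norm_le_iff_of_nonneg hR0]
    exact hbd k
  refine exists_tendsto_of_finite_mapClusterPt (isCompact_closedBall 0 R) hball hdist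
    (finite_setOf_slog_fixed y hX hlam) fun a ha j => ?_
  obtain ⟨φ, hφ, hlim⟩ := MapClusterPt.tendsto_subseq ha
  have hlim' : Tendsto (fun k => x (φ k + 1)) atTop (𝓝 a) := by
    simpa using hlim.add (hinc.comp hφ.tendsto_atTop)
  have hl := ((continuous_apply j).tendsto a).comp hlim'
  have hr := (((continuous_apply j).tendsto a).comp hlim).abs.mul
    (((continuous_apply j).comp (continuous_residualCorr y X)).tendsto a |>.comp hlim')
  refine tendsto_nhds_unique (hl.const_mul lam) (hr.congr fun k => ?_)
  exact (lam_mul_slogStep X y hlam (x (φ k)) j).symm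

/-- A SLOG sequence without vanishing coordinates converges to a KKT point. At a fixed point `β`
with `|q j| > lam` for some zero coordinate `β j`, the `j`-th coordinate of the sequence would
eventually grow in absolute value, since each step multiplies it by about `|q j| / lam`. -/
theorem exists_lassoKKT_tendsto_slogSeq (hX : ColumnsInGeneralPosition X) (hlam : 0 < lam)
    (b0 : Fin p → ℝ) (hne : ∀ k j, slogSeq X y lam b0 k j ≠ 0) :
    ∃ β : Fin p → ℝ, LassoKKT X y lam β ∧
      Tendsto (fun k => slogSeq X y lam b0 k) atTop (𝓝 β) := by
  obtain ⟨β, hfix, hlim⟩ := exists_tendsto_slogSeq y hX hlam b0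
  refine ⟨β, fun j => ?_, hlim⟩
  by_cases hβ : β j = 0
  · refine ⟨?_, by simp [hβ]⟩
    by_contra! hgt
    have hq : Tendsto (fun k => |residualCorr X y (slogSeq X y lam b0 (k + 1)) j|) atTop
        (𝓝 |residualCorr X y β j|) :=
      ((((continuous_apply j).comp (continuous_residualCorr y X)).tendsto β).comp
        (hlim.comp (tendsto_add_atTop_nat 1))).abs
    obtain ⟨N, hN⟩ := eventually_atTop.1 (hq.eventually (lt_mem_nhds hgt))
    have hmono : ∀ k, N ≤ k → |slogSeq X y lam b0 N j| ≤ |slogSeq X y lam b0 k j| := by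
      intro k hk
      induction k, hk using Nat.le_induction with
      | base => exact le_rfl
      | succ k hk ih =>
        refine ih.trans ?_
        have h := congrArg abs (lam_mul_slogStep X y hlam (slogSeq X y lam b0 k) j)
        rw [abs_mul, abs_mul, abs_abs, abs_of_pos hlam] at h
        refine le_of_mul_le_mul_left ?_ hlam
        change _ ≤ lam * |slogStep X y lam (slogSeq X y lam b0 k) j|
        rw [h, mul_comm lam]
        exact mul_le_mul_of_nonneg_left (hN k hk).le (abs_nonneg _)
    have hlimj : Tendsto (fun k => |slogSeq X y lam b0 k j|) atTop (𝓝 |β j|) :=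
      (((continuous_apply j).tendsto β).comp hlim).abs
    have hle := ge_of_tendsto hlimj (eventually_atTop.2 ⟨N, hmono⟩)
    rw [hβ, abs_zero] at hle
    exact hne N j (abs_nonpos_iff.1 hle)
  · have hq : residualCorr X y β j * β j = lam * |β j| := by
      refine mul_left_cancel₀ (abs_ne_zero.2 hβ) ?_
      linear_combination (-β j) * hfix j - lam * abs_mul_abs_self (β j)
    refine ⟨le_of_eq (mul_right_cancel₀ (abs_ne_zero.2 hβ) ?_), hq⟩
    have h := congrArg abs (hfix j)
    rw [abs_mul, abs_mul, abs_abs, abs_of_pos hlam] at h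
    rw [h, mul_comm]

end Convergence

/-! ### Null sets -/

/-- The zero set of a nonzero real polynomial is a Lebesgue null set. -/
theorem MvPolynomial.ae_eval_ne_zero {p : ℕ} {f : MvPolynomial (Fin p) ℝ} (hf : f ≠ 0) :
    ∀ᵐ w : Fin p → ℝ, MvPolynomial.eval w f ≠ 0 := by
  induction p with
  | zero =>
    refine Eventually.of_forall fun w hw => hf (MvPolynomial.funext fun x => ?_)
    rw [Subsingleton.elim x w, hw, map_zero]
  | succ p ih =>
    set g := MvPolynomial.finSuccEquiv ℝ p f with hg
    have hg0 : g ≠ 0 := (map_ne_zero_iff _ (MvPolynomial.finSuccEquiv ℝ p).injective).2 hf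
    have hmeas : MeasurableSet {z : ℝ × (Fin p → ℝ) |
        MvPolynomial.eval (Fin.cons z.1 z.2 : Fin (p + 1) → ℝ) f ≠ 0} := by
      refine (IsOpen.preimage (f := fun z : ℝ × (Fin p → ℝ) =>
        MvPolynomial.eval (Fin.cons z.1 z.2 : Fin (p + 1) → ℝ) f) ?_
        isOpen_compl_singleton).measurableSet
      exact (MvPolynomial.continuous_eval f).comp (by fun_prop)
    have hprod : ∀ᵐ z : ℝ × (Fin p → ℝ),
        MvPolynomial.eval (Fin.cons z.1 z.2 : Fin (p + 1) → ℝ) f ≠ 0 := by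
      rw [Measure.volume_eq_prod, Measure.ae_prod_iff_ae_ae hmeas, Measure.ae_ae_comm hmeas]
      filter_upwards [ih (Polynomial.leadingCoeff_ne_zero.2 hg0)] with s hs
      have hmap : g.map (MvPolynomial.eval s) ≠ 0 := fun h => hs <| by
        have := congrArg (fun q => q.coeff g.natDegree) h
        simpa using this
      have hroots : volume ((g.map (MvPolynomial.eval s)).rootSet ℝ) = 0 :=
        (Polynomial.rootSet_finite _ ℝ).measure_zero volume
      refine measure_mono_null (fun t ht => ?_) hroots
      have ht' : MvPolynomial.eval (Fin.cons t s : Fin (p + 1) → ℝ) f = 0 := by simpa using ht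
      rw [MvPolynomial.eval_eq_eval_mv_eval'] at ht'
      rw [Polynomial.mem_rootSet]
      exact ⟨hmap, by simpa using ht'⟩
    have h := (volume_preserving_piFinSuccAbove (fun _ : Fin (p + 1) => ℝ)
      0).quasiMeasurePreserving.ae hprod
    filter_upwards [h] with w hw
    have hcons : (Fin.cons (w 0) (fun i => w (Fin.succ i)) : Fin (p + 1) → ℝ) = w :=
      Fin.cons_self_tail w
    rw [← hcons]
    exact hw

/-- Null sets of absolute values pull back to null sets: the preimage is covered by the finitely
many images of the set under coordinatewise sign changes. -/
theorem volume_preimage_abs_eq_zero {p : ℕ} {N : Set (Fin p → ℝ)} (hN : volume N = 0) :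
    volume {b : Fin p → ℝ | (fun j => |b j|) ∈ N} = 0 := by
  have hsub : {b : Fin p → ℝ | (fun j => |b j|) ∈ N} ⊆
      ⋃ s : Fin p → SignType, (fun (w : Fin p → ℝ) j => (s j : ℝ) * w j) '' N := by
    intro b hb
    refine Set.mem_iUnion.2 ⟨fun j => SignType.sign (b j), _, hb, funext fun j => ?_⟩
    exact sign_mul_abs (b j)
  refine measure_mono_null hsub (measure_iUnion_null fun s => ?_)
  refine addHaar_image_eq_zero_of_differentiableOn_of_addHaar_eq_zero volume ?_ hN
  exact Differentiable.differentiableOn (by fun_prop)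

section NullSets

variable {n p : ℕ} (X : Matrix (Fin n) (Fin p) ℝ) (y : Fin n → ℝ) {lam : ℝ}

/-- Among the starting points whose SLOG step has no zero coordinate, those that step into a given
null set form a null set: the step `b'` determines `|b j| = lam * b' j / q j`, which is a
differentiable function of `b'`. -/
theorem volume_preimage_slogStep_eq_zero (hlam : 0 < lam) {N : Set (Fin p → ℝ)}
    (hN : volume N = 0) :
    volume {b | (∀ j, slogStep X y lam b j ≠ 0) ∧ slogStep X y lam b ∈ N} = 0 := by
  set U : Set (Fin p → ℝ) := {β | ∀ j, residualCorr X y β j ≠ 0} with hU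
  set φ : (Fin p → ℝ) → Fin p → ℝ := fun β j => lam * β j / residualCorr X y β j with hφ
  have hdiff : DifferentiableOn ℝ φ (N ∩ U) := by
    rw [differentiableOn_pi]
    intro j
    have hlin : (fun β => residualCorr X y β j) =
        fun β => (Xᵀ *ᵥ y) j - ∑ i, (Xᵀ * X) j i * β i := by
      funext β
      rw [residualCorr_eq]
      rfl
    have hden : DifferentiableOn ℝ (fun β => residualCorr X y β j) (N ∩ U) := by
      rw [hlin]
      fun_prop
    have hnum : DifferentiableOn ℝ (fun β : Fin p → ℝ => lam * β j) (N ∩ U) := by fun_prop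
    simp only [hφ, div_eq_mul_inv]
    exact hnum.fun_mul (hden.fun_inv fun β hβ => hβ.2 j)
  have hnull : volume (φ '' (N ∩ U)) = 0 :=
    addHaar_image_eq_zero_of_differentiableOn_of_addHaar_eq_zero volume hdiff
      (measure_mono_null Set.inter_subset_left hN)
  refine measure_mono_null ?_ (volume_preimage_abs_eq_zero hnull)
  rintro b ⟨hne, hbN⟩
  have hrel := lam_mul_slogStep X y hlam b
  have hq : ∀ j, residualCorr X y (slogStep X y lam b) j ≠ 0 := by
    intro j h0
    have := hrel j
    rw [h0, mul_zero] at this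
    exact hne j ((mul_eq_zero.1 this).resolve_left hlam.ne')
  refine ⟨_, ⟨hbN, hq⟩, funext fun j => ?_⟩
  rw [hφ]
  simp only
  rw [hrel j, mul_div_cancel_right₀ _ (hq j)]

end NullSets

/-! ### The system satisfied by the scaled residual correlations -/

/-- The matrix `lam I + G Diag(w)`. If `b'` is the SLOG step of a point with absolute values `w`,
then `u = Xᵀ (y - X b') / lam` solves the linear system of this matrix, with `G = Xᵀ X` and
right-hand side `Xᵀ y`, and `b' = Diag(w) u`. Cramer's rule then makes the numerators of `u`
polynomials in `w`, with no square roots. -/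
def scaledSystem {R : Type*} [CommRing R] {p : ℕ} (G : Matrix (Fin p) (Fin p) R) (lam : R)
    (w : Fin p → R) : Matrix (Fin p) (Fin p) R :=
  lam • 1 + G * diagonal w

/-- The polynomial in `w` that is the `j`-th Cramer numerator of the system with matrix
`lam I + G Diag(w)` and right-hand side `c`. -/
noncomputable def scaledNumerator {p : ℕ} (G : Matrix (Fin p) (Fin p) ℝ) (lam : ℝ)
    (c : Fin p → ℝ) (j : Fin p) : MvPolynomial (Fin p) ℝ :=
  cramer (scaledSystem (G.map MvPolynomial.C) (MvPolynomial.C lam) MvPolynomial.X)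
    (fun i => MvPolynomial.C (c i)) j

section ScaledSystem

variable {p : ℕ} (G : Matrix (Fin p) (Fin p) ℝ) (lam : ℝ)

theorem map_eval_scaledSystem (w : Fin p → ℝ) :
    (scaledSystem (G.map MvPolynomial.C) (MvPolynomial.C lam) MvPolynomial.X).map
      (MvPolynomial.eval w) = scaledSystem G lam w := by
  ext i j
  simp [scaledSystem, Matrix.one_apply, apply_ite (MvPolynomial.eval w)]

theorem eval_scaledNumerator (c : Fin p → ℝ) (j : Fin p) (w : Fin p → ℝ) :
    MvPolynomial.eval w (scaledNumerator G lam c j) = cramer (scaledSystem G lam w) c j := by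
  rw [scaledNumerator, cramer_apply, cramer_apply, RingHom.map_det, RingHom.mapMatrix_apply,
    Matrix.map_updateCol, map_eval_scaledSystem]
  congr 2
  funext i
  simp

/-- The numerator of the `i`-th coordinate does not involve the `i`-th variable, since Cramer's rule
replaces the only column containing it. -/
theorem cramer_scaledSystem_add_single (c : Fin p → ℝ) (i : Fin p) (w : Fin p → ℝ) (t : ℝ) :
    cramer (scaledSystem G lam (w + Pi.single i t)) c i = cramer (scaledSystem G lam w) c i := by
  rw [cramer_apply, cramer_apply]
  congr 1
  ext a k
  by_cases hk : k = i
  · simp [hk]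
  · simp [hk, scaledSystem]

theorem scaledSystem_add_single_mulVec (i : Fin p) (w u : Fin p → ℝ) (t : ℝ) :
    scaledSystem G lam (w + Pi.single i t) *ᵥ u =
      scaledSystem G lam w *ᵥ u + (t * u i) • Gᵀ i := by
  have h : diagonal (w + Pi.single i t) *ᵥ u = diagonal w *ᵥ u + Pi.single i (t * u i) := by
    funext k
    by_cases hk : k = i
    · subst hk; simp [mulVec_diagonal, add_mul]
    · simp [mulVec_diagonal, hk]
  rw [scaledSystem, scaledSystem, add_mulVec, add_mulVec, ← mulVec_mulVec, ← mulVec_mulVec, h,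
    mulVec_add, mulVec_single, add_assoc]
  congr 2
  funext k
  simp [mul_comm]

theorem scaledNumerator_eval_zero (c : Fin p → ℝ) (j : Fin p) :
    MvPolynomial.eval 0 (scaledNumerator G lam c j) = lam ^ (p - 1) * c j := by
  rw [eval_scaledNumerator]
  simp [scaledSystem, cramer_smul]

/-- If the `j`-th numerator vanishes identically and the `i`-th one does not, then `G j i = 0`.
Moving `w` by `e i` changes the right-hand side of the system by a multiple of the `i`-th column of
`G`, so that the product of the determinant, the `i`-th numerator and the `j`-th numerator with that
column as right-hand side vanishes identically; the last factor takes the value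
`lam ^ (p - 1) * G j i` at `w = 0`. -/
theorem entry_eq_zero_of_scaledNumerator_eq_zero (hlam : lam ≠ 0) (c : Fin p → ℝ) {i j : Fin p}
    (hj : scaledNumerator G lam c j = 0) (hi : scaledNumerator G lam c i ≠ 0) : G j i = 0 := by
  have hPj : ∀ w, cramer (scaledSystem G lam w) c j = 0 := fun w => by
    rw [← eval_scaledNumerator, hj, map_zero]
  set D : MvPolynomial (Fin p) ℝ :=
    (scaledSystem (G.map MvPolynomial.C) (MvPolynomial.C lam) MvPolynomial.X).det with hD
  have hDeval : ∀ w, MvPolynomial.eval w D = (scaledSystem G lam w).det := fun w => by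
    rw [hD, RingHom.map_det, RingHom.mapMatrix_apply, map_eval_scaledSystem]
  have hprod : D * scaledNumerator G lam c i * scaledNumerator G lam (Gᵀ i) j = 0 := by
    refine MvPolynomial.funext fun w => ?_
    rw [map_mul, map_mul, map_zero, hDeval, eval_scaledNumerator, eval_scaledNumerator]
    set M := scaledSystem G lam w with hM
    set M' := scaledSystem G lam (w + Pi.single i 1) with hM'
    set u := cramer M c with hu
    set u' := cramer M' c with hu'
    have h1 : M *ᵥ u = M.det • c := mulVec_cramer M c
    have h2 : M *ᵥ u' + u' i • Gᵀ i = M'.det • c := by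
      have h := scaledSystem_add_single_mulVec G lam i w u' 1
      rw [one_mul, ← hM', mulVec_cramer] at h
      exact h.symm
    have h3 : M *ᵥ (M'.det • u - M.det • u') = (M.det * u' i) • Gᵀ i := by
      rw [mulVec_sub, mulVec_smul, mulVec_smul, h1, eq_sub_of_add_eq h2, smul_sub, smul_smul,
        smul_smul, smul_smul, mul_comm M'.det, sub_sub_cancel]
    have h4 := congrFun (congrArg (fun v => M.adjugate *ᵥ v) h3) j
    simp only [mulVec_mulVec, adjugate_mul, smul_mulVec, one_mulVec, mulVec_smul,
      ← cramer_eq_adjugate_mulVec, Pi.smul_apply, Pi.sub_apply, smul_eq_mul] at h4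
    rw [hu, hPj, hu', hPj, cramer_scaledSystem_add_single] at h4
    rw [← h4]
    ring
  have hD0 : D ≠ 0 := fun h => by
    have h1 := hDeval 0
    rw [h, map_zero] at h1
    simp only [scaledSystem, diagonal_zero', Matrix.mul_zero, add_zero, det_smul, det_one,
      mul_one, Fintype.card_fin] at h1
    exact pow_ne_zero p hlam h1.symm
  have hlast := (mul_eq_zero.1 hprod).resolve_left (mul_ne_zero hD0 hi)
  have h0 := scaledNumerator_eval_zero G lam (Gᵀ i) j
  rw [hlast, map_zero] at h0
  exact (mul_eq_zero.1 h0.symm).resolve_left (pow_ne_zero _ hlam)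

end ScaledSystem

/-! ### SLOG sequences almost surely keep all coordinates nonzero -/

section AlmostSure

variable {n p : ℕ} {X : Matrix (Fin n) (Fin p) ℝ} {y : Fin n → ℝ} {lam : ℝ}

/-- The indices whose numerator vanishes identically form a block that is orthogonal to the other
columns and to `y`, so there are none. -/
theorem scaledNumerator_ne_zero (hXy : NoTrivialOrthogonalBlock X y) (hlam : 0 < lam)
    (hc : Xᵀ *ᵥ y ≠ 0) (j : Fin p) : scaledNumerator (Xᵀ * X) lam (Xᵀ *ᵥ y) j ≠ 0 := by
  classical
  intro hj
  set S : Finset (Fin p) :=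
    Finset.univ.filter fun i => scaledNumerator (Xᵀ * X) lam (Xᵀ *ᵥ y) i = 0 with hS
  have hmem : ∀ i, i ∈ S ↔ scaledNumerator (Xᵀ * X) lam (Xᵀ *ᵥ y) i = 0 := fun i => by simp [hS]
  have hcS : ∀ i ∈ S, (Xᵀ *ᵥ y) i = 0 := by
    intro i hi
    have h := scaledNumerator_eval_zero (Xᵀ * X) lam (Xᵀ *ᵥ y) i
    rw [(hmem i).1 hi, map_zero] at h
    exact (mul_eq_zero.1 h.symm).resolve_left (pow_ne_zero _ hlam.ne')
  have hSc : (Sᶜ).Nonempty := by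
    by_contra h
    rw [Finset.not_nonempty_iff_eq_empty, Finset.compl_eq_empty_iff] at h
    exact hc (funext fun i => hcS i (by simp [h]))
  obtain ⟨⟨i, hi, hne⟩, -⟩ := hXy S ⟨j, (hmem j).2 hj⟩ hSc fun i hi k hk =>
    entry_eq_zero_of_scaledNumerator_eq_zero _ lam hlam.ne' _ ((hmem i).1 hi)
      (fun h => Finset.mem_compl.1 hk ((hmem k).2 h))
  exact hne (hcS i hi)

theorem scaledSystem_mulVec_residualCorr (hlam : 0 < lam) (b : Fin p → ℝ) :
    scaledSystem (Xᵀ * X) lam (fun j => |b j|) *ᵥ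
      (lam⁻¹ • residualCorr X y (slogStep X y lam b)) = Xᵀ *ᵥ y := by
  have h : diagonal (fun j => |b j|) *ᵥ (lam⁻¹ • residualCorr X y (slogStep X y lam b)) =
      slogStep X y lam b := by
    funext j
    rw [mulVec_diagonal, Pi.smul_apply, smul_eq_mul, mul_left_comm, ← lam_mul_slogStep X y hlam,
      inv_mul_cancel_left₀ hlam.ne']
  rw [scaledSystem, add_mulVec, ← mulVec_mulVec, h, smul_mulVec, one_mulVec,
    smul_inv_smul₀ hlam.ne', residualCorr_eq, sub_add_cancel]

theorem ae_slogStep_ne_zero (hXy : NoTrivialOrthogonalBlock X y) (hlam : 0 < lam)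
    (hc : Xᵀ *ᵥ y ≠ 0) : ∀ᵐ b : Fin p → ℝ, ∀ j, slogStep X y lam b j ≠ 0 := by
  rw [ae_all_iff]
  intro j
  have hpoly : MvPolynomial.X j * scaledNumerator (Xᵀ * X) lam (Xᵀ *ᵥ y) j ≠ 0 :=
    mul_ne_zero (MvPolynomial.X_ne_zero j) (scaledNumerator_ne_zero hXy hlam hc j)
  refine measure_mono_null ?_ (volume_preimage_abs_eq_zero (MvPolynomial.ae_eval_ne_zero hpoly))
  intro b hb
  have hb0 : slogStep X y lam b j = 0 := by simpa using hb
  suffices |b j| * cramer (scaledSystem (Xᵀ * X) lam fun j => |b j|) (Xᵀ *ᵥ y) j = 0 by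
    change ¬ (MvPolynomial.eval (fun j => |b j|)
      (MvPolynomial.X j * scaledNumerator (Xᵀ * X) lam (Xᵀ *ᵥ y) j) ≠ 0)
    rw [not_not, map_mul, MvPolynomial.eval_X, eval_scaledNumerator, this]
  rw [← scaledSystem_mulVec_residualCorr hlam b, cramer_eq_adjugate_mulVec, mulVec_mulVec,
    adjugate_mul, smul_mulVec, one_mulVec]
  have h := lam_mul_slogStep X y hlam b j
  rw [hb0, mul_zero] at h
  simp only [Pi.smul_apply, smul_eq_mul]
  linear_combination (-(scaledSystem (Xᵀ * X) lam fun j => |b j|).det * lam⁻¹) * h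

theorem slogSeq_succ_eq (X : Matrix (Fin n) (Fin p) ℝ) (y : Fin n → ℝ) (lam : ℝ)
    (b0 : Fin p → ℝ) (k : ℕ) :
    slogSeq X y lam b0 (k + 1) = slogSeq X y lam (slogStep X y lam b0) k := by
  induction k with
  | zero => rfl
  | succ k ih => exact congrArg (slogStep X y lam) ih

theorem ae_slogSeq_ne_zero (hXy : NoTrivialOrthogonalBlock X y) (hlam : 0 < lam)
    (hc : Xᵀ *ᵥ y ≠ 0) : ∀ᵐ b0 : Fin p → ℝ, ∀ k j, slogSeq X y lam b0 k j ≠ 0 := by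
  rw [ae_all_iff]
  intro k
  induction k with
  | zero =>
    rw [ae_all_iff]
    intro j
    filter_upwards [MvPolynomial.ae_eval_ne_zero (MvPolynomial.X_ne_zero (R := ℝ) j)] with b hb
    simpa [slogSeq] using hb
  | succ k ih =>
    have hstep := volume_preimage_slogStep_eq_zero X y hlam ih
    filter_upwards [ae_slogStep_ne_zero hXy hlam hc, compl_mem_ae_iff.2 hstep] with b h1 h2
    rw [slogSeq_succ_eq]
    by_contra h
    exact h2 ⟨h1, h⟩

/-- For `Xᵀ y = 0` the first step already reaches the lasso solution `0`. -/
theorem exists_lassoKKT_tendsto_slogSeq_of_eq_zero (hlam : 0 < lam) (hc : Xᵀ *ᵥ y = 0)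
    (b0 : Fin p → ℝ) :
    ∃ β : Fin p → ℝ, LassoKKT X y lam β ∧
      Tendsto (fun k => slogSeq X y lam b0 k) atTop (𝓝 β) := by
  refine ⟨0, fun j => ?_, ?_⟩
  · simp [residualCorr_eq, hc, hlam.le]
  · refine (tendsto_add_atTop_iff_nat 1).1 (tendsto_const_nhds.congr fun k => ?_)
    simp [slogSeq, slogStep, hc]

end AlmostSure

/-! ### Convergence of SLOG to the lasso solution -/

theorem theorem1 {n p : ℕ} (X : Matrix (Fin n) (Fin p) ℝ) (y : Fin n → ℝ) (lam : ℝ)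
    (hlam : 0 < lam)
    (hX : ColumnsInGeneralPosition X)
    (hXy : NoTrivialOrthogonalBlock X y)
    (P₀ : Measure (Fin p → ℝ)) [IsProbabilityMeasure P₀] (hP₀ : P₀ ≪ volume) :
    ∃ βhat : Fin p → ℝ,
      (∀ β : Fin p → ℝ, IsLassoEstimator X y lam β ↔ β = βhat) ∧
      ∀ᵐ b0 ∂P₀, Tendsto (fun k : ℕ => slogSeq X y lam b0 k) atTop (𝓝 βhat) := by
  have hae : ∀ᵐ b0 ∂P₀, ∃ β : Fin p → ℝ, LassoKKT X y lam β ∧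
      Tendsto (fun k => slogSeq X y lam b0 k) atTop (𝓝 β) := by
    by_cases hc : Xᵀ *ᵥ y = 0
    · exact Eventually.of_forall (exists_lassoKKT_tendsto_slogSeq_of_eq_zero hlam hc)
    · filter_upwards [hP₀.ae_le (ae_slogSeq_ne_zero hXy hlam hc)] with b0 hb0
      exact exists_lassoKKT_tendsto_slogSeq y hX hlam b0 hb0
  -- A lasso solution exists because almost every SLOG sequence converges to one.
  obtain ⟨-, βhat, hβ, -⟩ := hae.exists
  refine ⟨βhat, hβ.isLassoEstimator_iff hX hlam, ?_⟩
  filter_upwards [hae] with b0 hb0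
  obtain ⟨β, hβ', hlim⟩ := hb0
  rwa [(hβ.isLassoEstimator_iff hX hlam β).1 ((hβ'.isLassoEstimator_iff hX hlam β).2 rfl)] at hlim
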